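/- **Setting.** Let $d\ge 1$ be an integer. Graphs are simple, undirected, with node set $V=[n]$; such a graph has *degree bound* $d$ if every node has at most $d$ neighbours. For nonempty $S\subseteq V$ let $\Phi(S)=|\partial S|/|S|$, where $\partial S$ is the set of nodes outside $S$ with a neighbour in $S$, and let $\Phi(G)=\min\{\Phi(S): \emptyset\ne S\subseteq V,\ |S|\le n/2\}$ (with $\min\emptyset=+\infty$). A graph $G=(V,E)$ is *$\epsilon$-far from having expansion $\ge\beta$* if $|E\,\triangle\,E'|/(nd)\ge\epsilon$ for every graph $G'=(V,E')$ with degree bound $d$ and $\Phi(G')\ge\beta$. For $G$ with degree bound $d$, make $G$ $d$-regular by adding $d-\deg(v)$ self-loops at each node $v$, and let $P$ be the transition matrix of the lazy random walk on the resulting graph: with probability $1/2$ it stands still, and otherwise it follows one of the $d$ edges and loops at the current node, chosen uniformly ($P(u,v)$ is the probability of a step from $v$ to $u$). Let $\phi(S)=|E(S,S^c)|/(d|S|)$, where $E(S,S^c)$ is the set of edges between $S$ and $S^c$. The *diffusion core* of $S$ is $$S_d=\Big\{v\in S:\ \Pr\big(\tau_v(S^c)>\tfrac{1}{40\,\phi(S)}\big)\ge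 \tfrac34\Big\},$$ where $\tau_v(S^c)$ is the hitting time of $S^c$ by the walk started from $v$ (if $\phi(S)=0$ the walk never leaves $S$, and $S_d=S$). A probability distribution $v$ on $V$ has *$\gamma$-overlap* with $S$ if $\sum_{u\in S}v(u)\ge\gamma$. Below, $\|\cdot\|$ is the Euclidean norm. **Lemma.** For every integer $d\ge1$ there is a constant $r_d>0$, depending only on $d$, such that the following holds. Let $G$ be an undirected $n$-node graph with degree bound $d$ that is $\epsilon$-far from having expansion $\ge\beta$, where $0<\epsilon\le 1$ and $\beta\le 1/10$. Then there exists a subset $A\subseteq V$ with $$\frac{\epsilon n}{12}\le |A|\le \frac{(1+\epsilon)n}{2}\qquad\text{and}\qquad \Phi(A)<r_d\,\beta,$$ and such that, for every integer $t\ge0$ with $t\le 1/(2r_d\beta)$, every real $\gamma>2(1+\epsilon)/3$ and every probability distribution $v$ on $V$ that has $\gamma$-overlap with the diffusion core of $A$, $$\|P^t v\|^2\ \ge\ \frac1n\left(1+4\left(\frac{3\gamma}{4}-\frac{1+\epsilon}{2}\right)^2\right).$$ -/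

import Mathlib

namespace ExpansionTesting

noncomputable section

open Classical in
/-- `G` has degree bound `d`: every node has at most `d` neighbours. -/
def HasDegreeBound {V : Type*} [Fintype V] (G : SimpleGraph V) (d : ℕ) : Prop :=
  ∀ v : V, G.degree v ≤ d

open Classical in
/-- The outer vertex boundary `∂S`: the nodes outside `S` that have a neighbour in `S`. -/
def vertexBoundary {V : Type*} [Fintype V] (G : SimpleGraph V) (S : Finset V) : Finset V :=
  Finset.univ.filter fun u => u ∉ S ∧ ∃ v ∈ S, G.Adj u v

/-- The vertex expansion `Φ(S) = |∂S| / |S|` of a nonempty node set `S`. -/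
def setExpansion {V : Type*} [Fintype V] (G : SimpleGraph V) (S : Finset V) : ℝ :=
  ((vertexBoundary G S).card : ℝ) / (S.card : ℝ)

/-- The vertex expansion `Φ(G)`: the minimum of `Φ(S)` over nonempty `S` with `|S| ≤ n / 2`.
It takes values in the extended reals, so that the minimum over an empty family (a graph with
at most one node) is `+∞`. -/
def graphExpansion {V : Type*} [Fintype V] (G : SimpleGraph V) : EReal :=
  ⨅ (S : Finset V) (_ : S.Nonempty) (_ : 2 * S.card ≤ Fintype.card V),
    ((setExpansion G S : ℝ) : EReal)

/-- The relative distance `|E ∆ E'| / (n d)` between two graphs on the same `n` nodes. -/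
def relDist {V : Type*} [Fintype V] (d : ℕ) (G G' : SimpleGraph V) : ℝ :=
  ((symmDiff G.edgeSet G'.edgeSet).ncard : ℝ) / ((Fintype.card V : ℝ) * (d : ℝ))

/-- `G` is `ε`-far from having expansion at least `β`: its relative distance to every graph on
the same nodes that has degree bound `d` and expansion at least `β` is at least `ε`. -/
def FarFromExpansion {V : Type*} [Fintype V] (G : SimpleGraph V) (d : ℕ) (ε β : ℝ) : Prop :=
  ∀ G' : SimpleGraph V, HasDegreeBound G' d → (β : EReal) ≤ graphExpansion G' →
    ε ≤ relDist d G G'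

open Classical in
/-- The transition matrix of the lazy random walk on the `d`-regular graph obtained from `G` by
adding `d - deg v` self-loops at every node `v`; `lazyWalk G d u v` is the probability of a step
from `v` to `u`. The walk stands still with probability `1 / 2`, and otherwise follows one of the
`d` edges and loops at its current node, chosen uniformly. -/
def lazyWalk {V : Type*} [Fintype V] (G : SimpleGraph V) (d : ℕ) : Matrix V V ℝ :=
  fun u v =>
    if u = v then 1 / 2 + ((d : ℝ) - (G.degree v : ℝ)) / (2 * (d : ℝ))
    else if G.Adj v u then 1 / (2 * (d : ℝ))
    else 0

open Classical in
/-- The conductance `φ(S) = |E(S, Sᶜ)| / (d |S|)` of `S` in the same `d`-regular graph; loops do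
not leave `S`, and the total degree of `S` is `d |S|`. -/
def conductance {V : Type*} [Fintype V] (G : SimpleGraph V) (d : ℕ) (S : Finset V) : ℝ :=
  ((G.interedges S Sᶜ).card : ℝ) / ((d : ℝ) * (S.card : ℝ))

open Classical in
/-- `Pr (τ_v(Sᶜ) > t)` for the Markov chain `X` with transition matrix `P` started from `v`, where
`τ_v(Sᶜ)` is the hitting time of `Sᶜ`. The event says that `X 0, …, X t` all lie in `S`, so its
probability is the sum over the trajectories `x` from `v` that stay inside `S` of
`∏ i, P (x (i + 1)) (x i)`. -/
def stayProb {V : Type*} [Fintype V] (P : Matrix V V ℝ) (S : Finset V) (v : V) (t : ℕ) : ℝ :=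
  ∑ x : Fin (t + 1) → V with x 0 = v ∧ ∀ i, x i ∈ S,
    ∏ i : Fin t, P (x i.succ) (x i.castSucc)

open Classical in
/-- The `(α, b)`-diffusion core of `S`: the nodes `v` of `S` with
`Pr (τ_v(Sᶜ) > α / φ(S)) ≥ b`. As `τ` is integer valued, `τ > x` is `τ > ⌊x⌋`. If `φ(S) = 0`, then
the walk never leaves `S`, and the core is all of `S` (for `b ≤ 1`), here by `α / 0 = 0`. -/
def diffusionCore {V : Type*} [Fintype V] (G : SimpleGraph V) (d : ℕ) (α b : ℝ)
    (S : Finset V) : Finset V :=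
  S.filter fun v => b ≤ stayProb (lazyWalk G d) S v ⌊α / conductance G d S⌋₊

/-- The canonical diffusion core, with parameters `(1 / 40, 3 / 4)`. -/
def canonicalCore {V : Type*} [Fintype V] (G : SimpleGraph V) (d : ℕ) (S : Finset V) :
    Finset V :=
  diffusionCore G d (1 / 40) (3 / 4) S

/-- The distribution `p` has `γ`-overlap with `S`: it gives `S` mass at least `γ`. -/
def HasOverlap {V : Type*} (p : V → ℝ) (γ : ℝ) (S : Finset V) : Prop :=
  γ ≤ ∑ u ∈ S, p u

end

end ExpansionTesting

/-! Let `K = 1 + d + d ^ 2`. The set `A` comes from a rewiring argument. Take a largest `U` with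
`|U| < εn/12` and `|∂U| ≤ Kβ|U|`. If some nonempty `S` disjoint from `U` with `|S| ≤ n/2` had `|∂S \
U| < Kβ|S|`, then `S ∪ U` would either contradict maximality or be the required `A`. Otherwise `G`
expands outside `U`. Strip the nodes of `U` of their edges and use them to subdivide `|U|` distinct
edges outside `U`: the result has degree bound `d` and expansion at least `β`, yet differs from `G`
in too few edges (`exists_expander_near`).

For the norm bound, `φ(A) ≤ Φ(A) < Kβ`, so up to time `1/(40Kβ)` a walk from the core is still in
`A` with probability at least `3/4`. Hence `A` keeps mass `3γ/4`, more than its density, and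
Cauchy–Schwarz turns this excess into Euclidean distance from uniform (`le_sum_sq_of_mass`). -/

namespace ExpansionTesting

/-! ### Staying probabilities and transport of mass -/

open Classical in
/-- Summing over the trajectories of length `t + 1` by their first step. -/
theorem stayProb_succ {V : Type*} [Fintype V] (P : Matrix V V ℝ) (S : Finset V) (v : V) (t : ℕ) :
    stayProb P S v (t + 1) = if v ∈ S then ∑ w, P w v * stayProb P S w t else 0 := by
  unfold stayProb
  simp only [Finset.sum_filter]
  rw [← (Fin.consEquiv (fun _ : Fin (t + 2) => V)).sum_comp, Fintype.sum_prod_type,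
    Finset.sum_eq_single v]
  · by_cases hv : v ∈ S
    · simp only [hv, if_true, Finset.mul_sum]
      rw [Finset.sum_comm]
      refine Finset.sum_congr rfl fun x _ => ?_
      rw [Finset.sum_eq_single (x 0)]
      · simp [Fin.forall_fin_succ (n := t + 1), Fin.prod_univ_succ, hv, Fin.consEquiv]
      · intro w _ hw
        simp [hw.symm]
      · simp
    · simp [Fin.forall_fin_succ (n := t + 1), hv, Fin.consEquiv]
  · intro w _ hw
    simp [hw, Fin.consEquiv]
  · simp

open Classical in
theorem stayProb_zero {V : Type*} [Fintype V] (P : Matrix V V ℝ) (S : Finset V) (v : V) :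
    stayProb P S v 0 = if v ∈ S then 1 else 0 := by
  unfold stayProb
  simp only [Finset.sum_filter]
  rw [← (Equiv.funUnique (Fin 1) V).symm.sum_comp, Finset.sum_eq_single v]
  · simp
  · intro w _ hw
    simp [hw]
  · simp

theorem stayProb_nonneg {V : Type*} [Fintype V] {P : Matrix V V ℝ} (hP : ∀ u v, 0 ≤ P u v)
    (S : Finset V) (v : V) (t : ℕ) : 0 ≤ stayProb P S v t :=
  Finset.sum_nonneg fun _ _ => Finset.prod_nonneg fun _ _ => hP _ _

theorem stayProb_succ_le {V : Type*} [Fintype V] {P : Matrix V V ℝ} (hP : ∀ u v, 0 ≤ P u v)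
    (hP1 : ∀ v, ∑ u, P u v = 1) (S : Finset V) (v : V) (t : ℕ) :
    stayProb P S v (t + 1) ≤ stayProb P S v t := by
  classical
  induction t generalizing v with
  | zero =>
    rw [stayProb_succ, stayProb_zero]
    split_ifs
    · rw [← hP1 v]
      refine Finset.sum_le_sum fun w _ => ?_
      rw [stayProb_zero]
      refine mul_le_of_le_one_right (hP _ _) ?_
      split_ifs <;> norm_num
    · exact le_rfl
  | succ t ih =>
    rw [stayProb_succ P S v (t + 1), stayProb_succ P S v t]
    split_ifs
    · exact Finset.sum_le_sum fun w _ => mul_le_mul_of_nonneg_left (ih w) (hP _ _)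
    · exact le_rfl

theorem stayProb_antitone {V : Type*} [Fintype V] {P : Matrix V V ℝ} (hP : ∀ u v, 0 ≤ P u v)
    (hP1 : ∀ v, ∑ u, P u v = 1) (S : Finset V) (v : V) : Antitone (stayProb P S v) :=
  antitone_nat_of_succ_le fun t => stayProb_succ_le hP hP1 S v t

/-- The walk that has not left `S` before time `t` is in `S` at time `t`. -/
theorem stayProb_le_sum_pow {V : Type*} [Fintype V] [DecidableEq V] {P : Matrix V V ℝ}
    (hP : ∀ u v, 0 ≤ P u v) (S : Finset V) (v : V) (t : ℕ) :
    stayProb P S v t ≤ ∑ u ∈ S, (P ^ t) u v := by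
  induction t generalizing v with
  | zero =>
    rw [stayProb_zero]
    simp only [pow_zero, Matrix.one_apply, Finset.sum_ite_eq']
    split_ifs <;> exact le_rfl
  | succ t ih =>
    have h : ∑ u ∈ S, (P ^ (t + 1)) u v = ∑ w, P w v * ∑ u ∈ S, (P ^ t) u w := by
      simp only [pow_succ, Matrix.mul_apply, Finset.mul_sum]
      rw [Finset.sum_comm]
      simp only [mul_comm]
    have h' : ∑ w, P w v * stayProb P S w t ≤ ∑ u ∈ S, (P ^ (t + 1)) u v := by
      rw [h]
      exact Finset.sum_le_sum fun w _ => mul_le_mul_of_nonneg_left (ih w) (hP _ _)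
    rw [stayProb_succ]
    split_ifs
    · exact h'
    · exact (Finset.sum_nonneg fun w _ => mul_nonneg (hP _ _) (stayProb_nonneg hP S w t)).trans h'

/-- A walk that cannot step out of `S` stays in `S`. -/
theorem stayProb_eq_one {V : Type*} [Fintype V] {P : Matrix V V ℝ}
    (hP1 : ∀ v, ∑ u, P u v = 1) {S : Finset V} (hS : ∀ v ∈ S, ∀ u ∉ S, P u v = 0)
    {v : V} (hv : v ∈ S) (t : ℕ) : stayProb P S v t = 1 := by
  classical
  induction t generalizing v with
  | zero => simp [stayProb_zero, hv]
  | succ t ih =>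
    rw [stayProb_succ, if_pos hv, ← hP1 v]
    refine Finset.sum_congr rfl fun w _ => ?_
    by_cases hw : w ∈ S
    · rw [ih hw, mul_one]
    · rw [hS v hv w hw, zero_mul]

theorem lazyWalk_nonneg {V : Type*} [Fintype V] {G : SimpleGraph V} {d : ℕ}
    (hG : HasDegreeBound G d) (u v : V) : 0 ≤ lazyWalk G d u v := by
  classical
  have h : (G.degree v : ℝ) ≤ d := by exact_mod_cast hG v
  unfold lazyWalk
  split_ifs
  · have : 0 ≤ ((d : ℝ) - G.degree v) / (2 * d) := div_nonneg (by linarith) (by positivity)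
    linarith
  · positivity
  · exact le_rfl

theorem sum_lazyWalk {V : Type*} [Fintype V] (G : SimpleGraph V) {d : ℕ} (hd : 1 ≤ d) (v : V) :
    ∑ u, lazyWalk G d u v = 1 := by
  classical
  have hd' : (d : ℝ) ≠ 0 := by positivity
  have h : ∀ u, lazyWalk G d u v =
      (if u = v then 1 / 2 + ((d : ℝ) - (G.degree v : ℝ)) / (2 * (d : ℝ)) else 0) +
      (if G.Adj v u then 1 / (2 * (d : ℝ)) else 0) := by
    intro u
    unfold lazyWalk
    by_cases huv : u = v
    · subst huv; simp
    · simp [huv]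
  simp only [h, Finset.sum_add_distrib, Finset.sum_ite_eq', Finset.mem_univ, if_true]
  rw [← Finset.sum_filter, Finset.sum_const, ← SimpleGraph.neighborFinset_eq_filter,
    SimpleGraph.card_neighborFinset_eq_degree, nsmul_eq_mul]
  field_simp
  ring

theorem mass_pow_mulVec {V : Type*} [Fintype V] [DecidableEq V] {P : Matrix V V ℝ}
    (hP1 : ∀ v, ∑ u, P u v = 1) (p : V → ℝ) (t : ℕ) :
    ∑ u, ((P ^ t).mulVec p) u = ∑ u, p u := by
  induction t with
  | zero => simp
  | succ t ih =>
    rw [← ih, pow_succ', ← Matrix.mulVec_mulVec]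
    simp only [Matrix.mulVec, dotProduct] at *
    rw [Finset.sum_comm]
    simp only [← Finset.sum_mul, hP1, one_mul]

/-- If every walk started in `C` stays in `S` with probability at least `b` for `t` steps, then
after `t` steps `S` has at least the fraction `b` of the mass that `C` had initially. -/
theorem mul_sum_le_sum_pow_mulVec {V : Type*} [Fintype V] [DecidableEq V] {P : Matrix V V ℝ}
    (hP : ∀ u v, 0 ≤ P u v) {S C : Finset V} {b : ℝ} {t : ℕ}
    (hC : ∀ v ∈ C, b ≤ stayProb P S v t) {p : V → ℝ} (hp : ∀ v, 0 ≤ p v) :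
    b * ∑ v ∈ C, p v ≤ ∑ u ∈ S, ((P ^ t).mulVec p) u := by
  have h : ∑ u ∈ S, ((P ^ t).mulVec p) u = ∑ v, (∑ u ∈ S, (P ^ t) u v) * p v := by
    simp only [Matrix.mulVec, dotProduct, Finset.sum_mul]
    rw [Finset.sum_comm]
  have h0 : ∀ v, 0 ≤ ∑ u ∈ S, (P ^ t) u v := fun v =>
    (stayProb_nonneg hP S v t).trans (stayProb_le_sum_pow hP S v t)
  rw [h, Finset.mul_sum]
  refine (Finset.sum_le_sum fun v hv => ?_).trans
    (Finset.sum_le_sum_of_subset_of_nonneg (Finset.subset_univ C)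
      fun v _ _ => mul_nonneg (h0 v) (hp v))
  exact mul_le_mul_of_nonneg_right ((hC v hv).trans (stayProb_le_sum_pow hP S v t)) (hp v)

/-! ### From excess mass to the Euclidean norm -/

/-- A vector of total mass `1` that puts mass `m` on a set of density at most `a ≤ m` is at
distance at least `2 (m - a) / √n` from the uniform distribution. -/
theorem le_sum_sq_of_mass {V : Type*} [Fintype V] [Nonempty V] {q : V → ℝ} (hq : ∑ u, q u = 1)
    {S : Finset V} {a m : ℝ} (ha : (S.card : ℝ) ≤ a * Fintype.card V) (ham : a ≤ m)
    (hm : m ≤ ∑ u ∈ S, q u) :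
    1 / (Fintype.card V : ℝ) * (1 + 4 * (m - a) ^ 2) ≤ ∑ u, q u ^ 2 := by
  classical
  set n : ℝ := (Fintype.card V : ℝ) with hn
  have hn0 : 0 < n := by simp [hn, Fintype.card_pos]
  set s : ℝ := (S.card : ℝ)
  set M := ∑ u ∈ S, q u
  have h1 : ∑ u, (q u - 1 / n) * ((if u ∈ S then 1 else 0) - s / n) = M - s / n := by
    have : ∀ u, (q u - 1 / n) * ((if u ∈ S then 1 else 0) - s / n) =
        (if u ∈ S then q u else 0) - (if u ∈ S then 1 / n else 0) - s / n * q u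
          + s / n * (1 / n) := by
      intro u; split_ifs <;> ring
    simp only [this, Finset.sum_add_distrib, Finset.sum_sub_distrib, ← Finset.mul_sum, hq,
      Finset.sum_ite_mem, Finset.univ_inter, Finset.sum_const, Finset.card_univ, nsmul_eq_mul,
      ← hn]
    change M - s * (1 / n) - s / n * 1 + s / n * (n * (1 / n)) = _
    field_simp
    ring
  have h2 : ∑ u, (q u - 1 / n) ^ 2 = ∑ u, q u ^ 2 - 1 / n := by
    have : ∀ u, (q u - 1 / n) ^ 2 = q u ^ 2 - 2 / n * q u + 1 / n ^ 2 := by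
      intro u; ring
    simp only [this, Finset.sum_add_distrib, Finset.sum_sub_distrib, ← Finset.mul_sum, hq,
      Finset.sum_const, Finset.card_univ, nsmul_eq_mul, ← hn]
    field_simp
    ring
  have h3 : ∑ u : V, ((if u ∈ S then (1 : ℝ) else 0) - s / n) ^ 2 = s - s ^ 2 / n := by
    have : ∀ u : V, ((if u ∈ S then (1 : ℝ) else 0) - s / n) ^ 2 =
        (if u ∈ S then 1 - 2 * (s / n) else 0) + (s / n) ^ 2 := by
      intro u; split_ifs <;> ring
    simp only [this, Finset.sum_add_distrib, Finset.sum_ite_mem, Finset.univ_inter,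
      Finset.sum_const, Finset.card_univ, nsmul_eq_mul, ← hn]
    change s * _ + _ = _
    field_simp
    ring
  -- Cauchy–Schwarz for `q` minus uniform against the centred indicator of `S`. The squared norm `s
  -- - s ^ 2 / n` of the latter is at most `n / 4`, which gives the factor `4`.
  have hcs := Finset.sum_mul_sq_le_sq_mul_sq Finset.univ (fun u => q u - 1 / n)
    (fun u => (if u ∈ S then (1 : ℝ) else 0) - s / n)
  rw [h1, h2, h3] at hcs
  have h4 : s - s ^ 2 / n ≤ n / 4 := by
    have : n / 4 - (s - s ^ 2 / n) = (n - 2 * s) ^ 2 / (4 * n) := by field_simp; ring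
    have h5 : 0 ≤ (n - 2 * s) ^ 2 / (4 * n) := by positivity
    linarith
  have h5 : 0 ≤ ∑ u, q u ^ 2 - 1 / n := h2 ▸ Finset.sum_nonneg fun u _ => sq_nonneg _
  have h6 : s / n ≤ a := by rwa [div_le_iff₀ hn0]
  have h7 : (m - a) ^ 2 ≤ (M - s / n) ^ 2 := by
    apply pow_le_pow_left₀ <;> linarith
  have h8 : (m - a) ^ 2 ≤ (∑ u, q u ^ 2 - 1 / n) * (n / 4) :=
    h7.trans (hcs.trans (mul_le_mul_of_nonneg_left h4 h5))
  have h9 : 1 / n * (4 * (m - a) ^ 2) ≤ ∑ u, q u ^ 2 - 1 / n := by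
    rw [div_mul_eq_mul_div, one_mul, div_le_iff₀ hn0]
    linarith
  linarith

/-! ### Conductance and walks from the core -/

/-- Each node outside `S` receives at most `d` edges from `S`, so the conductance of `S` is at most
its vertex expansion. -/
theorem conductance_le_setExpansion {V : Type*} [Fintype V] {G : SimpleGraph V} {d : ℕ}
    (hd : 1 ≤ d) (hG : HasDegreeBound G d) (S : Finset V) :
    conductance G d S ≤ setExpansion G S := by
  classical
  have h : (G.interedges S Sᶜ).card ≤ d * (vertexBoundary G S).card := by
    have hsub : G.interedges S Sᶜ ⊆
        (vertexBoundary G S).biUnion fun u => (G.neighborFinset u).image fun v => (v, u) := by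
      rintro ⟨v, u⟩ h
      rw [SimpleGraph.mem_interedges_iff] at h
      simp only [Finset.mem_compl] at h
      simp only [Finset.mem_biUnion, vertexBoundary, Finset.mem_filter, Finset.mem_univ, true_and,
        Finset.mem_image, SimpleGraph.mem_neighborFinset]
      exact ⟨u, ⟨h.2.1, v, h.1, h.2.2.symm⟩, v, h.2.2.symm, rfl⟩
    refine (Finset.card_le_card hsub).trans (Finset.card_biUnion_le.trans ?_)
    rw [mul_comm]
    refine Finset.sum_le_card_nsmul _ _ _ fun u _ => Finset.card_image_le.trans ?_
    have := hG u
    rw [SimpleGraph.card_neighborFinset_eq_degree]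
    convert this
  have h' : ((G.interedges S Sᶜ).card : ℝ) ≤ d * (vertexBoundary G S).card := by exact_mod_cast h
  have hd' : (0 : ℝ) < d := by positivity
  unfold conductance setExpansion
  calc _ ≤ (d * (vertexBoundary G S).card : ℝ) / (d * S.card) := by
        apply div_le_div_of_nonneg_right _ (by positivity)
        convert h'
    _ = _ := mul_div_mul_left _ _ hd'.ne'

theorem lazyWalk_eq_zero_of_conductance_eq_zero {V : Type*} [Fintype V] {G : SimpleGraph V} {d : ℕ}
    (hd : 1 ≤ d) {S : Finset V} (hS : conductance G d S = 0) {v : V} (hv : v ∈ S) {u : V}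
    (hu : u ∉ S) : lazyWalk G d u v = 0 := by
  classical
  have hSc : (S.card : ℝ) ≠ 0 := by
    simpa using Finset.ne_empty_of_mem hv
  have hd' : (d : ℝ) ≠ 0 := by positivity
  have hadj : ¬ G.Adj v u := by
    intro h
    unfold conductance at hS
    rw [div_eq_zero_iff, or_iff_left (mul_ne_zero hd' hSc), Nat.cast_eq_zero,
      Finset.card_eq_zero] at hS
    have : (v, u) ∈ G.interedges S Sᶜ := by
      rw [SimpleGraph.mem_interedges_iff]
      exact ⟨hv, by simpa using hu, h⟩
    have h2 : (v, u) ∈ (∅ : Finset (V × V)) := by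
      rw [← hS]; convert this
    simp at h2
  have huv : u ≠ v := fun h => hu (h ▸ hv)
  simp [lazyWalk, huv, hadj]

/-- Walks from the canonical core stay in `S` with probability at least `3 / 4`. -/
theorem le_stayProb_of_mem_canonicalCore {V : Type*} [Fintype V] {G : SimpleGraph V} {d : ℕ}
    (hd : 1 ≤ d) (hG : HasDegreeBound G d) {S : Finset V} {t : ℕ}
    (ht : 40 * t * conductance G d S ≤ 1) {v : V} (hv : v ∈ canonicalCore G d S) :
    3 / 4 ≤ stayProb (lazyWalk G d) S v t := by
  classical
  simp only [canonicalCore, diffusionCore, Finset.mem_filter] at hv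
  have h0 : 0 ≤ conductance G d S := by unfold conductance; positivity
  -- At zero conductance the time in the core's definition is `0`, so membership says nothing about
  -- later times; there the walk cannot leave `S` at all.
  rcases h0.eq_or_lt with h | h
  · rw [stayProb_eq_one (sum_lazyWalk G hd)
      (fun v hv u hu => lazyWalk_eq_zero_of_conductance_eq_zero hd h.symm hv hu) hv.1]
    norm_num
  · refine hv.2.trans (stayProb_antitone (lazyWalk_nonneg hG) (sum_lazyWalk G hd) S v ?_)
    apply Nat.le_floor
    rw [le_div_iff₀ h]
    linarith

end ExpansionTesting
-- Rewiring by subdivision of edges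
namespace ExpansionTesting

/-- The graph obtained from `G` by deleting the edges at `U` and then subdividing, for each
`u ∈ U`, the edge `f u` by the node `u`. -/
def subdivide {V : Type*} (G : SimpleGraph V) (U : Finset V) (f : V → Sym2 V)
    (hf : ∀ u ∈ U, ∀ w ∈ f u, w ∉ U) : SimpleGraph V where
  Adj a b := (a ∉ U ∧ b ∉ U ∧ G.Adj a b ∧ ∀ u ∈ U, f u ≠ s(a, b)) ∨ (a ∈ U ∧ b ∈ f a) ∨
    (b ∈ U ∧ a ∈ f b)
  symm := ⟨by
    rintro a b (⟨ha, hb, h, h'⟩ | h | h)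
    · exact Or.inl ⟨hb, ha, h.symm, by simpa only [Sym2.eq_swap] using h'⟩
    · exact Or.inr (Or.inr h)
    · exact Or.inr (Or.inl h)⟩
  loopless := ⟨by
    rintro a (⟨_, _, h, _⟩ | ⟨h, h'⟩ | ⟨h, h'⟩)
    · exact h.ne rfl
    · exact hf a h a h' h
    · exact hf a h a h' h⟩

section

variable {V : Type*} [Fintype V] [DecidableEq V] {G : SimpleGraph V} {d : ℕ} {U : Finset V} {f : V → Sym2 V}
  (hf : ∀ u ∈ U, ∀ w ∈ f u, w ∉ U)

/-- A node of `U` is joined only to the ends of its edge, which is where `2 ≤ d` enters. For a node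
outside `U`, new neighbours inject into old ones: a surviving neighbour goes to itself, a
subdividing node to the far end of its edge. -/
theorem subdivide_hasDegreeBound (hG : HasDegreeBound G d) (hfG : ∀ u ∈ U, f u ∈ G.edgeSet)
    (hinj : Set.InjOn f U) (hd : 2 ≤ d ∨ U = ∅) : HasDegreeBound (subdivide G U f hf) d := by
  classical
  intro v
  by_cases hv : v ∈ U
  · have hd2 : 2 ≤ d := hd.resolve_right (Finset.ne_empty_of_mem hv)
    refine le_trans ?_ hd2
    have hsub : (subdivide G U f hf).neighborFinset v ⊆ (f v).toFinset := by
      intro w hw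
      rw [SimpleGraph.mem_neighborFinset] at hw
      rw [Sym2.mem_toFinset]
      rcases hw with h | h | h
      · exact absurd hv h.1
      · exact h.2
      · exact absurd hv (hf w h.1 v h.2)
    have h2 := Finset.card_le_card hsub
    rw [SimpleGraph.card_neighborFinset_eq_degree, Sym2.card_toFinset] at h2
    have h3 : (subdivide G U f hf).degree v ≤ 2 := h2.trans (by split_ifs <;> norm_num)
    convert h3
  · refine le_trans ?_ (hG v)
    have key : ∀ w ∈ (subdivide G U f hf).neighborFinset v, ∃ z ∈ G.neighborFinset v,
        (w ∉ U ∧ z = w ∧ ∀ u ∈ U, f u ≠ s(v, w)) ∨ (w ∈ U ∧ f w = s(v, z)) := by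
      intro w hw
      rw [SimpleGraph.mem_neighborFinset] at hw
      rcases hw with h | h | h
      · exact ⟨w, by simpa using h.2.2.1, Or.inl ⟨h.2.1, rfl, h.2.2.2⟩⟩
      · exact absurd h.1 hv
      · obtain ⟨z, hz⟩ := h.2
        refine ⟨z, ?_, Or.inr ⟨h.1, hz⟩⟩
        have := hfG w h.1
        rw [hz, SimpleGraph.mem_edgeSet] at this
        simpa using this
    choose! g hg hg' using key
    rw [← SimpleGraph.card_neighborFinset_eq_degree, ← SimpleGraph.card_neighborFinset_eq_degree]
    refine le_trans (le_of_eq ?_) ((Finset.card_le_card_of_injOn g hg ?_).trans (le_of_eq ?_))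
    · congr
    · intro w hw w' hw' hww
      rcases hg' w hw with ⟨h1, h2, h3⟩ | ⟨h1, h2⟩ <;>
        rcases hg' w' hw' with ⟨h1', h2', h3'⟩ | ⟨h1', h2'⟩
      · rw [← h2, ← h2', hww]
      · rw [← hww, h2] at h2'
        exact absurd h2' (h3 _ h1')
      · rw [hww, h2'] at h2
        exact absurd h2 (h3' _ h1)
      · exact hinj h1 h1' (by rw [h2, h2', hww])
    · congr

/-- Subdividing edges does not shrink the boundary. -/
theorem card_vertexBoundary_sdiff_le (S : Finset V) :
    (vertexBoundary G {v ∈ S | v ∉ U} \ U).card ≤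
      (vertexBoundary (subdivide G U f hf) S).card := by
  classical
  -- If the edge from `s` to `w` is subdivided by `u`, then `w` stays in the boundary when `u ∈ S`,
  -- and `u` replaces it otherwise. This is injective, since `w` is the only end of `f u` outside
  -- `S`.
  have key : ∀ w ∈ vertexBoundary G {v ∈ S | v ∉ U} \ U,
      ∃ z ∈ vertexBoundary (subdivide G U f hf) S,
        w ∉ U ∧ (z = w ∨ (z ∈ U ∧ ∃ s ∈ S, w ∉ S ∧ f z = s(s, w))) := by
    intro w hw
    simp only [vertexBoundary, Finset.mem_sdiff, Finset.mem_filter, Finset.mem_univ,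
      true_and] at hw ⊢
    obtain ⟨⟨hwS, s, ⟨hs, hsU⟩, hadj⟩, hwU⟩ := hw
    have hwS' : w ∉ S := fun h => hwS ⟨h, hwU⟩
    by_cases h : ∃ u ∈ U, f u = s(s, w)
    · obtain ⟨u, hu, hfu⟩ := h
      by_cases huS : u ∈ S
      · exact ⟨w, ⟨hwS', u, huS, Or.inr (Or.inr ⟨hu, by simp [hfu]⟩)⟩, hwU, Or.inl rfl⟩
      · exact ⟨u, ⟨huS, s, hs, Or.inr (Or.inl ⟨hu, by simp [hfu]⟩)⟩, hwU,
          Or.inr ⟨hu, s, hs, hwS', hfu⟩⟩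
    · push Not at h
      exact ⟨w, ⟨hwS', s, hs, Or.inl ⟨hwU, hsU, hadj, by
        simpa only [Sym2.eq_swap] using h⟩⟩, hwU, Or.inl rfl⟩
  choose! g hg hgU hg' using key
  refine Finset.card_le_card_of_injOn g hg ?_
  intro w hw w' hw' hww
  have hU := hgU w hw
  have hU' := hgU w' hw'
  rcases hg' w hw with h | ⟨h1, s, h2, h3, h4⟩ <;>
    rcases hg' w' hw' with h' | ⟨h1', s', h2', h3', h4'⟩
  · rw [← h, ← h', hww]
  · rw [← hww, h] at h1'
    exact absurd h1' hU
  · rw [hww, h'] at h1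
    exact absurd h1 hU'
  · rw [hww, h4', Sym2.eq_iff] at h4
    rcases h4 with h | h
    · exact h.2.symm
    · exact absurd (h.1 ▸ h2') h3

/-- Each `u` in `S ∩ U` has a neighbour outside `U`, which lies in `S` or in its new boundary; a
node is chosen this way at most `d` times. -/
theorem card_inter_subdivided_le (hG' : HasDegreeBound (subdivide G U f hf) d) (S : Finset V) :
    {v ∈ S | v ∈ U}.card ≤
      d * ({v ∈ S | v ∉ U}.card + (vertexBoundary (subdivide G U f hf) S).card) := by
  classical
  have hmem : ∀ u, ∃ w, w ∈ f u := fun u => by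
    induction f u with | _ a b
    exact ⟨a, by simp⟩
  choose x hx using hmem
  set T := {v ∈ S | v ∉ U} ∪ vertexBoundary (subdivide G U f hf) S
  have hT : ∀ u ∈ {v ∈ S | v ∈ U}, x u ∈ T := by
    intro u hu
    rw [Finset.mem_filter] at hu
    have := hf u hu.2 _ (hx u)
    simp only [T, Finset.mem_union, Finset.mem_filter, vertexBoundary, Finset.mem_univ, true_and]
    by_cases hS : x u ∈ S
    · exact Or.inl ⟨hS, this⟩
    · exact Or.inr ⟨hS, u, hu.1, Or.inr (Or.inr ⟨hu.2, hx u⟩)⟩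
  refine (Finset.card_le_mul_card_image_of_maps_to hT d fun z _ => ?_).trans
    (Nat.mul_le_mul_left _ (Finset.card_union_le _ _))
  refine le_trans ?_ (hG' z)
  rw [← SimpleGraph.card_neighborFinset_eq_degree]
  refine Finset.card_le_card fun u hu => ?_
  rw [Finset.mem_filter, Finset.mem_filter] at hu
  rw [SimpleGraph.mem_neighborFinset]
  exact Or.inr (Or.inr ⟨hu.1.2, hu.2 ▸ hx u⟩)

/-- Each `u ∈ U` accounts for at most `d` deleted edges at `u`, the deleted edge `f u`, and two new
edges. -/
theorem ncard_symmDiff_subdivide_le (hG : HasDegreeBound G d) :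
    (symmDiff G.edgeSet (subdivide G U f hf).edgeSet).ncard ≤ (d + 3) * U.card := by
  classical
  have hsub : symmDiff G.edgeSet (subdivide G U f hf).edgeSet ⊆
      ((U.biUnion fun u => (G.neighborFinset u).image (fun w => s(u, w)) ∪
        ({f u} ∪ (f u).toFinset.image fun w => s(u, w)) : Finset (Sym2 V)) : Set (Sym2 V)) := by
    intro e
    induction e with | _ a b
    simp only [Set.mem_symmDiff, SimpleGraph.mem_edgeSet, Finset.coe_biUnion, Set.mem_iUnion,
      Finset.mem_coe, Finset.mem_union, Finset.mem_image, SimpleGraph.mem_neighborFinset,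
      Finset.mem_singleton, Sym2.mem_toFinset]
    rintro (⟨h, h'⟩ | ⟨h | h | h, h'⟩)
    · by_cases ha : a ∈ U
      · exact ⟨a, ha, Or.inl ⟨b, h, rfl⟩⟩
      by_cases hb : b ∈ U
      · exact ⟨b, hb, Or.inl ⟨a, h.symm, Sym2.eq_swap⟩⟩
      by_contra hcon
      exact h' (Or.inl ⟨ha, hb, h, fun u hu hfu => hcon ⟨u, hu, Or.inr (Or.inl hfu.symm)⟩⟩)
    · exact absurd h.2.2.1 h'
    · exact ⟨a, h.1, Or.inr (Or.inr ⟨b, h.2, rfl⟩)⟩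
    · exact ⟨b, h.1, Or.inr (Or.inr ⟨a, h.2, Sym2.eq_swap⟩)⟩
  refine (Set.ncard_le_ncard hsub (Finset.finite_toSet _)).trans ?_
  rw [Set.ncard_coe_finset]
  refine Finset.card_biUnion_le.trans ?_
  rw [mul_comm]
  refine Finset.sum_le_card_nsmul _ _ _ fun u _ => ?_
  have h1 : ((G.neighborFinset u).image fun w => s(u, w)).card ≤ d := by
    refine Finset.card_image_le.trans ?_
    rw [SimpleGraph.card_neighborFinset_eq_degree]
    have := hG u
    convert this
  have h2 : ((f u).toFinset.image fun w => s(u, w)).card ≤ 2 := by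
    refine Finset.card_image_le.trans ?_
    rw [Sym2.card_toFinset]
    split_ifs <;> norm_num
  have h3 : ({f u} ∪ (f u).toFinset.image fun w => s(u, w)).card ≤ 3 := by
    refine (Finset.card_union_le _ _).trans ?_
    rw [Finset.card_singleton]
    omega
  exact (Finset.card_union_le _ _).trans (by omega)

end

/-! ### Existence of a nearby expander and of the set `A` -/

/-- If outside `U` there are no isolated nodes and at least `2 |U|` nodes, then there are `|U|`
different edges outside `U`. -/
theorem exists_injOn_edges {V : Type*} [Fintype V] {G : SimpleGraph V} {U : Finset V}
    (hU : 3 * U.card ≤ Fintype.card V) (hW : ∀ w ∉ U, ∃ z ∉ U, G.Adj w z) :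
    ∃ f : V → Sym2 V, (∀ u ∈ U, f u ∈ G.edgeSet ∧ ∀ w ∈ f u, w ∉ U) ∧ Set.InjOn f U := by
  classical
  set F : Finset (Sym2 V) := {e | e ∈ G.edgeSet ∧ ∀ w ∈ e, w ∉ U}
  -- The edges in `F` cover `Uᶜ`, two nodes at a time, so there are at least `|Uᶜ| / 2 ≥ |U|` of
  -- them.
  have hF : Uᶜ ⊆ F.biUnion Sym2.toFinset := by
    intro w hw
    rw [Finset.mem_compl] at hw
    obtain ⟨z, hz, hadj⟩ := hW w hw
    simp only [Finset.mem_biUnion, Sym2.mem_toFinset]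
    exact ⟨s(w, z), by simp [F, hadj, hw, hz], by simp⟩
  have h1 : Uᶜ.card ≤ F.card * 2 := by
    refine (Finset.card_le_card hF).trans (Finset.card_biUnion_le.trans ?_)
    refine Finset.sum_le_card_nsmul _ _ _ fun e _ => ?_
    rw [Sym2.card_toFinset]
    split_ifs <;> norm_num
  rw [Finset.card_compl] at h1
  have h2 : U.card ≤ F.card := by omega
  rcases U.eq_empty_or_nonempty with rfl | ⟨u₀, hu₀⟩
  · exact ⟨fun v => s(v, v), by simp, by simp⟩
  have : Nonempty (Sym2 V) := ⟨s(u₀, u₀)⟩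
  obtain ⟨f, hf, hinj⟩ := U.finite_toSet.exists_injOn_of_encard_le (t := (F : Set (Sym2 V)))
    (by simpa only [Set.encard_coe_eq_coe_finsetCard, Nat.cast_le] using h2)
  refine ⟨f, fun u hu => ?_, hinj⟩
  have := hf hu
  simpa [F] using this

/-- A graph that expands outside of a small set `U` is close to an expander. -/
theorem exists_expander_near {V : Type*} [Fintype V] [DecidableEq V] {G : SimpleGraph V} {d : ℕ} (hd : 1 ≤ d)
    (hG : HasDegreeBound G d) {U : Finset V} (hU : 11 * U.card ≤ Fintype.card V)
    (hV : 2 ≤ Fintype.card V) {β : ℝ} (hβ : 0 < β)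
    (hexp : ∀ S : Finset V, S.Nonempty → Disjoint S U → 2 * S.card ≤ Fintype.card V →
      (1 + d + d ^ 2) * β * S.card ≤ (vertexBoundary G S \ U).card) :
    ∃ G' : SimpleGraph V, HasDegreeBound G' d ∧ (β : EReal) ≤ graphExpansion G' ∧
      (symmDiff G.edgeSet G'.edgeSet).ncard ≤ (d + 3) * U.card := by
  classical
  have hpos : ∀ S : Finset V, S.Nonempty → Disjoint S U → 2 * S.card ≤ Fintype.card V →
      (vertexBoundary G S \ U).Nonempty := by
    intro S hS hSU hSc
    rw [← Finset.card_pos]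
    have h1 := hexp S hS hSU hSc
    have h2 : (0 : ℝ) < S.card := by exact_mod_cast hS.card_pos
    have h3 : (0 : ℝ) < (1 + d + d ^ 2) * β * S.card := by positivity
    exact_mod_cast h3.trans_le h1
  have hW : ∀ w ∉ U, ∃ z ∉ U, G.Adj w z := by
    intro w hw
    obtain ⟨z, hz⟩ := hpos {w} (by simp) (by simpa using hw) (by simpa using hV)
    simp only [vertexBoundary, Finset.mem_sdiff, Finset.mem_filter, Finset.mem_singleton,
      exists_eq_left] at hz
    exact ⟨z, hz.2, hz.1.2.2.symm⟩
  obtain ⟨w₀, hw₀⟩ : ∃ w, w ∉ U := by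
    by_contra! h
    have : U = Finset.univ := Finset.eq_univ_iff_forall.2 h
    rw [this, Finset.card_univ] at hU
    omega
  have hdeg : ∀ S : Finset V, S.card = 1 → (vertexBoundary G S).card ≤ d := by
    intro S hS
    obtain ⟨w, rfl⟩ := Finset.card_eq_one.1 hS
    refine le_trans ?_ (hG w)
    rw [← SimpleGraph.card_neighborFinset_eq_degree]
    refine Finset.card_le_card fun z hz => ?_
    simp only [vertexBoundary, Finset.mem_filter, Finset.mem_singleton, exists_eq_left] at hz
    rw [SimpleGraph.mem_neighborFinset]
    exact hz.2.2.symm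
  -- A single node has at most `d` boundary nodes.
  have hβd : (1 + d + d ^ 2) * β ≤ d := by
    have h1 := hexp {w₀} (by simp) (by simpa using hw₀) (by simpa using hV)
    have h2 : (vertexBoundary G {w₀} \ U).card ≤ d :=
      (Finset.card_le_card Finset.sdiff_subset).trans (hdeg _ (by simp))
    have h3 : ((vertexBoundary G {w₀} \ U).card : ℝ) ≤ d := by exact_mod_cast h2
    simpa using h1.trans h3
  -- If `d = 1`, an edge outside `U` is a whole component, so its two ends do not expand; `U ≠ ∅`
  -- makes `n ≥ 11`, so this pair is small enough to count.
  have hd2 : 2 ≤ d ∨ U = ∅ := by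
    by_contra! hcon
    obtain ⟨h1, hne⟩ := hcon
    have hUc := hne.card_pos
    obtain ⟨z₀, hz₀, hadj⟩ := hW w₀ hw₀
    obtain ⟨y, hy⟩ := hpos {w₀, z₀} (by simp) (by
        simp [Finset.disjoint_insert_left, hw₀, hz₀])
      (by have := Finset.card_le_two (a := w₀) (b := z₀); omega)
    simp only [vertexBoundary, Finset.mem_sdiff, Finset.mem_filter, Finset.mem_univ, true_and,
      Finset.mem_insert, Finset.mem_singleton, exists_eq_or_imp, exists_eq_left, not_or] at hy
    have htwo : ∀ a b c : V, b ≠ c → G.Adj a b → G.Adj a c → False := by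
      intro a b c hbc hab hac
      have h2 : ({b, c} : Finset V) ⊆ G.neighborFinset a := by
        intro x hx
        rw [Finset.mem_insert, Finset.mem_singleton] at hx
        rw [SimpleGraph.mem_neighborFinset]
        rcases hx with rfl | rfl <;> assumption
      have h3 := Finset.card_le_card h2
      rw [Finset.card_pair hbc, SimpleGraph.card_neighborFinset_eq_degree] at h3
      have h4 : G.degree a ≤ d := by
        have := hG a
        convert this
      omega
    rcases hy.1.2 with h | h
    · exact htwo w₀ z₀ y (Ne.symm hy.1.1.2) hadj h.symm
    · exact htwo z₀ w₀ y (Ne.symm hy.1.1.1) hadj.symm h.symm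
  obtain ⟨f, hf, hinj⟩ := exists_injOn_edges (by omega) hW
  have hG' := subdivide_hasDegreeBound (fun u hu => (hf u hu).2) hG (fun u hu => (hf u hu).1)
    hinj hd2
  refine ⟨_, hG', ?_, ncard_symmDiff_subdivide_le (fun u hu => (hf u hu).2) hG⟩
  refine le_iInf fun S => le_iInf fun hS => le_iInf fun hSc => ?_
  rw [EReal.coe_le_coe_iff, setExpansion, le_div_iff₀ (by exact_mod_cast hS.card_pos)]
  have h1 := card_vertexBoundary_sdiff_le (G := G) (fun u hu => (hf u hu).2) S
  have h2 := card_inter_subdivided_le (fun u hu => (hf u hu).2) hG' S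
  have h3 := Finset.card_filter_add_card_filter_not (s := S) (· ∈ U)
  have h4 : (1 + d + d ^ 2) * β * {v ∈ S | v ∉ U}.card ≤
      (vertexBoundary G {v ∈ S | v ∉ U} \ U).card := by
    rcases {v ∈ S | v ∉ U}.eq_empty_or_nonempty with h | h
    · simp [h]
    · refine hexp _ h ?_ (by omega)
      rw [Finset.disjoint_left]
      intro v hv
      exact (Finset.mem_filter.1 hv).2
  set a := {v ∈ S | v ∉ U}.card
  set b := {v ∈ S | v ∈ U}.card
  set D := (vertexBoundary (subdivide G U f _) S).card
  have h1' : (1 + d + d ^ 2) * β * a ≤ (D : ℝ) := h4.trans (by exact_mod_cast h1)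
  have h2' : (b : ℝ) ≤ d * (a + D) := by exact_mod_cast h2
  have h3' : (S.card : ℝ) = b + a := by exact_mod_cast h3.symm
  have hK : (0 : ℝ) < 1 + d + d ^ 2 := by positivity
  have h5 : β * S.card ≤ (1 + d) * (β * a) + d * β * D := by
    rw [h3']
    have := mul_le_mul_of_nonneg_left h2' hβ.le
    linarith
  -- Multiplied by `K = 1 + d + d ^ 2`, the two terms of `h5` are at most `(1 + d) * D` and `d ^ 2 *
  -- D`, which add up to `K * D`: this dictates `K`.
  have h6 := mul_le_mul_of_nonneg_left h1' (show (0 : ℝ) ≤ 1 + d by positivity)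
  have h7 := mul_le_mul_of_nonneg_right hβd (show (0 : ℝ) ≤ d * D by positivity)
  refine le_of_mul_le_mul_left ((mul_le_mul_of_nonneg_left h5 hK.le).trans ?_) hK
  linarith

theorem exists_set_of_farFromExpansion {V : Type*} [Fintype V] {G : SimpleGraph V} {d : ℕ}
    (hd : 1 ≤ d) (hG : HasDegreeBound G d) {ε β : ℝ} (hε : 0 < ε) (hε1 : ε ≤ 1)
    (hfar : FarFromExpansion G d ε β) :
    2 ≤ Fintype.card V ∧ 0 < β ∧ ∃ A : Finset V, ε * Fintype.card V / 12 ≤ A.card ∧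
      A.card ≤ (1 + ε) * Fintype.card V / 2 ∧
      setExpansion G A < (1 + d + d ^ 2) * β := by
  classical
  -- `G` is at distance `0` from itself. This excludes `n ≤ 1`, where the expansion is `+∞`, and `β
  -- ≤ 0`.
  have hnot : ¬ (β : EReal) ≤ graphExpansion G := by
    intro h
    have := hfar G hG h
    simp only [relDist, symmDiff_self, Set.bot_eq_empty, Set.ncard_empty, Nat.cast_zero,
      zero_div] at this
    linarith
  have hV : 2 ≤ Fintype.card V := by
    by_contra hcon
    refine hnot (le_iInf fun S => le_iInf fun hS => le_iInf fun hSc => ?_)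
    have := hS.card_pos
    omega
  have hβ : 0 < β := by
    by_contra! hcon
    refine hnot (le_iInf fun S => le_iInf fun hS => le_iInf fun hSc => ?_)
    rw [EReal.coe_le_coe_iff]
    exact hcon.trans (by unfold setExpansion; positivity)
  refine ⟨hV, hβ, ?_⟩
  by_contra! hcon
  set n : ℝ := (Fintype.card V : ℝ) with hn
  have hn0 : (0 : ℝ) < n := by rw [hn]; exact_mod_cast (by omega : 0 < Fintype.card V)
  set c : ℝ := (1 + d + d ^ 2) * β with hc
  have hεn : 0 < ε * n := mul_pos hε hn0
  have hεn' : ε * n ≤ n := by nlinarith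
  set 𝒰 : Finset (Finset V) := {U | (U.card : ℝ) < ε * n / 12 ∧
    ((vertexBoundary G U).card : ℝ) ≤ c * U.card} with h𝒰
  have h𝒰ne : 𝒰.Nonempty := ⟨∅, by
    simp only [h𝒰, Finset.mem_filter, Finset.mem_univ, true_and]
    constructor
    · simp only [Finset.card_empty, Nat.cast_zero]; linarith
    · simp [vertexBoundary]⟩
  obtain ⟨U, hU𝒰, hmax⟩ := Finset.exists_max_image 𝒰 Finset.card h𝒰ne
  simp only [h𝒰, Finset.mem_filter, Finset.mem_univ, true_and] at hU𝒰 hmax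
  obtain ⟨hU1, hU2⟩ := hU𝒰
  have hU11 : 11 * U.card ≤ Fintype.card V := by
    have : (11 : ℝ) * U.card ≤ n := by linarith
    rw [hn] at this
    exact_mod_cast this
  obtain ⟨G', hG', hexp', hdist⟩ := exists_expander_near hd hG hU11 hV hβ (by
    intro S hS hSU hSc
    by_contra! hlt
    have hcard : (S ∪ U).card = S.card + U.card := Finset.card_union_of_disjoint hSU
    have hcard' : ((S ∪ U).card : ℝ) = S.card + U.card := by exact_mod_cast hcard
    have hbd : vertexBoundary G (S ∪ U) ⊆ (vertexBoundary G S \ U) ∪ vertexBoundary G U := by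
      intro w
      simp only [vertexBoundary, Finset.mem_filter, Finset.mem_univ, true_and, Finset.mem_union,
        Finset.mem_sdiff, not_or]
      rintro ⟨⟨h1, h2⟩, v, hv | hv, hadj⟩
      · exact Or.inl ⟨⟨h1, v, hv, hadj⟩, h2⟩
      · exact Or.inr ⟨h2, v, hv, hadj⟩
    have hbd' : ((vertexBoundary G (S ∪ U)).card : ℝ) ≤
        (vertexBoundary G S \ U).card + (vertexBoundary G U).card := by
      exact_mod_cast (Finset.card_le_card hbd).trans (Finset.card_union_le _ _)
    have hlt' : ((vertexBoundary G (S ∪ U)).card : ℝ) < c * (S ∪ U).card := by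
      rw [hcard', mul_add]
      linarith
    have hSpos : (0 : ℝ) < S.card := by exact_mod_cast hS.card_pos
    have hSc' : 2 * (S.card : ℝ) ≤ n := by rw [hn]; exact_mod_cast hSc
    -- The union is either small, against maximality of `U`, or large, with size at most `n/2 +
    -- εn/12`, against `hcon`.
    by_cases hsmall : ((S ∪ U).card : ℝ) < ε * n / 12
    · have := hmax _ ⟨hsmall, hlt'.le⟩
      have := hS.card_pos
      omega
    · have := hcon (S ∪ U) (by linarith) (by rw [hcard']; linarith)
      rw [setExpansion, le_div_iff₀ (by rw [hcard']; positivity)] at this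
      linarith)
  have := hfar G' hG' hexp'
  have hd0 : (1 : ℝ) ≤ d := by exact_mod_cast hd
  rw [relDist, le_div_iff₀ (by positivity)] at this
  have hdist' : ((symmDiff G.edgeSet G'.edgeSet).ncard : ℝ) ≤ (d + 3) * U.card := by
    exact_mod_cast hdist
  -- As `d + 3 ≤ 4d`, fewer than `εnd/3` edges change.
  have h1 : ((d : ℝ) + 3) * U.card ≤ 4 * d * U.card := by
    apply mul_le_mul_of_nonneg_right _ (by positivity)
    linarith
  have h2 : 4 * d * (U.card : ℝ) < 4 * d * (ε * n / 12) :=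
    mul_lt_mul_of_pos_left hU1 (by positivity)
  have h3 : 0 < ε * n * d := by positivity
  linarith

end ExpansionTesting
-- Proof of the lemma
theorem lemma2p6 (d : ℕ) (hd : 1 ≤ d) :
    ∃ r : ℝ, 0 < r ∧
      ∀ (n : ℕ) (G : SimpleGraph (Fin n)) (ε β : ℝ),
        ExpansionTesting.HasDegreeBound G d → 0 < ε → ε ≤ 1 → β ≤ 1 / 10 →
        ExpansionTesting.FarFromExpansion G d ε β →
        ∃ A : Finset (Fin n),
          ε * (n : ℝ) / 12 ≤ (A.card : ℝ) ∧
          (A.card : ℝ) ≤ (1 + ε) * (n : ℝ) / 2 ∧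
          ExpansionTesting.setExpansion G A < r * β ∧
          ∀ (t : ℕ) (γ : ℝ) (p : Fin n → ℝ),
            (t : ℝ) ≤ 1 / (2 * r * β) →
            2 * (1 + ε) / 3 < γ →
            p ∈ stdSimplex ℝ (Fin n) →
            ExpansionTesting.HasOverlap p γ (ExpansionTesting.canonicalCore G d A) →
            1 / (n : ℝ) * (1 + 4 * (3 * γ / 4 - (1 + ε) / 2) ^ 2) ≤
              ‖WithLp.toLp 2 (Matrix.mulVec (ExpansionTesting.lazyWalk G d ^ t) p)‖ ^ 2 := by
  have hK : (0 : ℝ) < 1 + d + d ^ 2 := by positivity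
  -- The factor `20` makes `2r = 40K`, matching the `1 / 40` in the canonical core.
  refine ⟨20 * (1 + d + d ^ 2), by positivity, ?_⟩
  intro n G ε β hG hε hε1 _ hfar
  obtain ⟨hn, hβ, A, hA1, hA2, hA3⟩ :=
    ExpansionTesting.exists_set_of_farFromExpansion hd hG hε hε1 hfar
  rw [Fintype.card_fin] at hn hA1 hA2
  have hKβ : 0 < (1 + d + d ^ 2) * β := mul_pos hK hβ
  refine ⟨A, hA1, hA2, by linarith, ?_⟩
  intro t γ p ht hγ hp hov
  have : Nonempty (Fin n) := ⟨⟨0, by omega⟩⟩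
  have hcond : 40 * t * ExpansionTesting.conductance G d A ≤ 1 := by
    have h1 := (ExpansionTesting.conductance_le_setExpansion hd hG A).trans hA3.le
    rw [le_div_iff₀ (by positivity)] at ht
    have h2 := mul_le_mul_of_nonneg_left h1 (show (0 : ℝ) ≤ 40 * t by positivity)
    linarith
  have hmass := ExpansionTesting.mul_sum_le_sum_pow_mulVec (ExpansionTesting.lazyWalk_nonneg hG)
    (fun v hv => ExpansionTesting.le_stayProb_of_mem_canonicalCore hd hG hcond hv) hp.1
  have hov' : γ ≤ ∑ u ∈ ExpansionTesting.canonicalCore G d A, p u := hov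
  have hsum := ExpansionTesting.mass_pow_mulVec (ExpansionTesting.sum_lazyWalk G hd) p t
  rw [hp.2] at hsum
  have := ExpansionTesting.le_sum_sq_of_mass (a := (1 + ε) / 2) (m := 3 * γ / 4) hsum
    (S := A) (by rw [Fintype.card_fin]; linarith) (by linarith) (by linarith)
  rw [Fintype.card_fin] at this
  rw [EuclideanSpace.real_norm_sq_eq]
  exact this
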